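/- Let $c$ be a positive integer and $d$ a non-negative integer. Let $G$ be a finite group that is $d$-generated (that is, there are elements $g_1,\dots,g_d\in G$, not necessarily distinct, with $G=\langle g_1,\dots,g_d\rangle$), and assume that every orbit of the natural action of the automorphism group $\operatorname{Aut}(G)$ on $G$ has length at most $c$. Then \[ |G|\leqslant c^{\,d\cdot c^d\cdot(1+\lfloor d\log_2 c\rfloor)}+1. \] -/

import Mathlib

/-!
Let `m = |G : Z(G)|`, and let every `Aut G`-orbit have at most `c` elements. An automorphism is
determined by the images of the `d` generators, so `m ≤ |Aut G| ≤ c ^ d`. By transfer, `x ↦ x ^ m`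
is a homomorphism `G → Z(G)`; hence `x ↦ x ^ k` is an automorphism whenever `k ≡ 1` modulo `m` and
`k` is coprime to `|G|`. Counting the powers of `g` obtained in this way shows that the order of
`g ^ m` has totient at most `c`, so the image of the transfer, an abelian group on `d` generators,
has exponent at most `2 * c ^ 2` and order at most `(2 * c ^ 2) ^ d`. It contains `Z(G) ^ m`, whose
index in `Z(G)` is at most `m ^ (m * d)` because `Z(G)` is generated by `m * d` elements (Schreier).
Multiplying the three factors gives `|G| ≤ m * m ^ (m * d) * (2 * c ^ 2) ^ d`.

For `c ≥ 2` this is small enough once `d ≥ 2`, while `m = 1` for `d ≤ 1`. For `c = 1` the group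
`Aut G` is trivial: triviality of the inner automorphisms, of inversion and of the transvections
successively makes `G` abelian, a vector space over the field of two elements, and of dimension at
most one.
-/

open Subgroup
open scoped IsMulCommutative

section Totient

theorem le_totient_sq_of_odd {n : ℕ} (hn : Odd n) : n ≤ n.totient ^ 2 := by
  induction n using Nat.recOnPosPrimePosCoprime with
  | zero => exact Nat.zero_le _
  | one => simp
  | prime_pow p k hp hk =>
    obtain ⟨q, rfl⟩ : ∃ q, p = q + 1 := ⟨p - 1, (Nat.sub_add_cancel hp.one_le).symm⟩
    have hq : 2 ≤ q := by
      have hp_odd : Odd (q + 1) := hn.of_dvd_nat (dvd_pow_self _ hk.ne')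
      have := hp.two_le
      grind
    calc (q + 1) ^ k = (q + 1) ^ (k - 1) * (q + 1) := (pow_sub_one_mul hk.ne' _).symm
      _ ≤ ((q + 1) ^ (k - 1)) ^ 2 * q ^ 2 :=
        Nat.mul_le_mul (Nat.le_self_pow two_ne_zero _) (by nlinarith)
      _ = ((q + 1) ^ k).totient ^ 2 := by
        rw [Nat.totient_prime_pow hp hk, Nat.add_sub_cancel, mul_pow]
  | coprime a b _ _ hab iha ihb =>
    rw [Nat.odd_mul] at hn
    rw [Nat.totient_mul hab, mul_pow]
    exact Nat.mul_le_mul (iha hn.1) (ihb hn.2)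

theorem le_two_mul_totient_sq (n : ℕ) : n ≤ 2 * n.totient ^ 2 := by
  rcases eq_or_ne n 0 with rfl | hn
  · exact Nat.zero_le _
  obtain ⟨k, l, hl, rfl⟩ := Nat.exists_eq_two_pow_mul_odd hn
  have two_pow_le : 2 ^ k ≤ 2 * (2 ^ k).totient ^ 2 := by
    rcases k with _ | j
    · simp
    · rw [Nat.totient_prime_pow_succ Nat.prime_two, Nat.add_one_sub_one, mul_one, pow_succ']
      exact Nat.mul_le_mul_left 2 (Nat.le_self_pow two_ne_zero _)
  rw [Nat.totient_mul ((Nat.coprime_two_left.2 hl).pow_left k), mul_pow, ← mul_assoc]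
  exact Nat.mul_le_mul two_pow_le (le_totient_sq_of_odd hl)

end Totient

section ZModUnits

variable {m n : ℕ}

theorem card_ker_unitsMap_mul_totient [NeZero n] (h : m ∣ n) :
    Nat.card (ZMod.unitsMap h).ker * m.totient = n.totient := by
  have : NeZero m := ⟨ne_zero_of_dvd_ne_zero (NeZero.ne n) h⟩
  rw [← ZMod.card_units_eq_totient m, ← ZMod.card_units_eq_totient n, ← Nat.card_eq_fintype_card,
    ← Nat.card_eq_fintype_card, ← (ZMod.unitsMap h).ker.card_mul_index, index_ker,
    MonoidHom.range_eq_top.2 (ZMod.unitsMap_surjective h), card_top]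

theorem natCast_val_eq_unitsMap [NeZero n] (h : m ∣ n) (u : (ZMod n)ˣ) :
    ((u : ZMod n).val : ZMod m) = ZMod.unitsMap h u := by
  rw [ZMod.unitsMap_val, ZMod.natCast_val]

theorem val_modEq_one_of_mem_ker_unitsMap [NeZero n] (h : m ∣ n) {u : (ZMod n)ˣ}
    (hu : u ∈ (ZMod.unitsMap h).ker) : (u : ZMod n).val ≡ 1 [MOD m] := by
  rw [← ZMod.natCast_eq_natCast_iff, natCast_val_eq_unitsMap h, MonoidHom.mem_ker.1 hu,
    Units.val_one, Nat.cast_one]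

theorem exists_modEq_coprime {k : ℕ} [NeZero m] [NeZero n] (hk : k.Coprime m) :
    ∃ l, l ≡ k [MOD m] ∧ l.Coprime n := by
  have h : m ∣ m * n := dvd_mul_right m n
  obtain ⟨v, hv⟩ := ZMod.unitsMap_surjective h (ZMod.unitOfCoprime k hk)
  refine ⟨(v : ZMod (m * n)).val, ?_,
    (ZMod.val_coe_unit_coprime v).coprime_dvd_right (dvd_mul_left n m)⟩
  rw [← ZMod.natCast_eq_natCast_iff, natCast_val_eq_unitsMap h, hv, ZMod.coe_unitOfCoprime]

end ZModUnits

section PowerAutomorphisms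

variable {G : Type*} [Group G]

theorem mul_pow_of_modEq_one_index_center [FiniteIndex (center G)] {k : ℕ}
    (hk : k ≡ 1 [MOD (center G).index]) (x y : G) : (x * y) ^ k = x ^ k * y ^ k := by
  obtain ⟨t, ht⟩ := Nat.modEq_iff_dvd.1 hk.symm
  let f (z : G) : center G := MonoidHom.transferCenterPow G z ^ t
  have pow_eq (z : G) : z ^ k = z * f z := by
    rw [← zpow_natCast, show (k : ℤ) = 1 + (center G).index * t by push_cast at ht; linarith,
      zpow_add, zpow_one, zpow_mul, zpow_natCast, coe_zpow, MonoidHom.transferCenterPow_apply]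
  have f_mul : f (x * y) = f x * f y := by
    simp only [f, map_mul, mul_zpow]
  have f_comm : y * f x = f x * y := mem_center_iff.1 (f x).2 y
  rw [pow_eq, pow_eq, pow_eq, f_mul, coe_mul, mul_assoc, mul_assoc, ← mul_assoc y, f_comm,
    mul_assoc]

variable [Finite G]

theorem lcm_orderOf_eq_mul_orderOf_pow (m : ℕ) (g : G) :
    m.lcm (orderOf g) = m * orderOf (g ^ m) := by
  rw [orderOf_pow, Nat.lcm, Nat.gcd_comm, Nat.mul_div_assoc _ (Nat.gcd_dvd_left _ _)]

theorem pow_mem_orbit_mulAut {k : ℕ} {g : G} (hk : k ≡ 1 [MOD (center G).index])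
    (hg : k.Coprime (orderOf g)) : g ^ k ∈ MulAction.orbit (MulAut G) g := by
  have : NeZero (center G).index := ⟨FiniteIndex.index_ne_zero⟩
  have : NeZero (orderOf g) := ⟨(orderOf_pos g).ne'⟩
  have : NeZero (Nat.card G) := ⟨Nat.card_pos.ne'⟩
  have hk_cop : k.Coprime (center G).index := by
    rw [Nat.Coprime, hk.gcd_eq, Nat.gcd_one_left]
  obtain ⟨l, hlk, hl⟩ := exists_modEq_coprime (n := Nat.card G) (hk_cop.mul_right hg)
  have pow_l_eq : g ^ l = g ^ k := pow_eq_pow_iff_modEq.2 (hlk.of_dvd (dvd_mul_left _ _))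
  have hl_one : l ≡ 1 [MOD (center G).index] := (hlk.of_dvd (dvd_mul_right _ _)).trans hk
  let powAut : MulAut G :=
    { powCoprime hl.symm with map_mul' := mul_pow_of_modEq_one_index_center hl_one }
  exact ⟨powAut, pow_l_eq⟩

theorem card_ker_unitsMap_le_ncard_orbit_mulAut (g : G) :
    Nat.card (ZMod.unitsMap (Nat.dvd_lcm_left (center G).index (orderOf g))).ker ≤
      (MulAction.orbit (MulAut G) g).ncard := by
  set m := (center G).index
  have : NeZero (m.lcm (orderOf g)) :=
    ⟨Nat.lcm_ne_zero FiniteIndex.index_ne_zero (orderOf_pos g).ne'⟩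
  let K := (ZMod.unitsMap (Nat.dvd_lcm_left m (orderOf g))).ker
  have val_modEq (u : K) : (u.1 : ZMod (m.lcm (orderOf g))).val ≡ 1 [MOD m] :=
    val_modEq_one_of_mem_ker_unitsMap _ u.2
  have pow_mem (u : K) :
      g ^ (u.1 : ZMod (m.lcm (orderOf g))).val ∈ MulAction.orbit (MulAut G) g :=
    pow_mem_orbit_mulAut (val_modEq u)
      ((ZMod.val_coe_unit_coprime u.1).coprime_dvd_right (Nat.dvd_lcm_right _ _))
  rw [← Nat.card_coe_set_eq]
  refine Nat.card_le_card_of_injective (fun u : K => ⟨_, pow_mem u⟩) fun u w huw => ?_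
  have modEq_orderOf := pow_eq_pow_iff_modEq.1 (congrArg Subtype.val huw)
  have modEq_index := (val_modEq u).trans (val_modEq w).symm
  have modEq_lcm := Nat.modEq_iff_dvd.2 <| Int.natCast_dvd.2 <| Nat.lcm_dvd
    (Int.natCast_dvd.1 modEq_index.dvd) (Int.natCast_dvd.1 modEq_orderOf.dvd)
  rw [← ZMod.natCast_eq_natCast_iff, ZMod.natCast_zmod_val, ZMod.natCast_zmod_val] at modEq_lcm
  exact Subtype.ext (Units.ext modEq_lcm)

theorem totient_orderOf_pow_index_center_le (g : G) :
    (orderOf (g ^ (center G).index)).totient ≤ (MulAction.orbit (MulAut G) g).ncard := by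
  set m := (center G).index
  have hm : 0 < m := Nat.pos_of_ne_zero FiniteIndex.index_ne_zero
  have : NeZero (m.lcm (orderOf g)) := ⟨Nat.lcm_ne_zero hm.ne' (orderOf_pos g).ne'⟩
  refine le_trans ?_ (card_ker_unitsMap_le_ncard_orbit_mulAut g)
  refine Nat.le_of_mul_le_mul_right ?_ (Nat.totient_pos.2 hm)
  rw [card_ker_unitsMap_mul_totient, lcm_orderOf_eq_mul_orderOf_pow, mul_comm]
  exact Nat.totient_super_multiplicative _ _

end PowerAutomorphisms

section TrivialAutomorphismGroup

theorem rank_le_one_of_subsingleton_linearEquiv {K V : Type*} [Field K] [AddCommGroup V]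
    [Module K V] [Subsingleton (V ≃ₗ[K] V)] : Module.rank K V ≤ 1 := by
  rw [rank_le_one_iff]
  rcases subsingleton_or_nontrivial V with _ | _
  · exact ⟨0, fun v => ⟨0, Subsingleton.elim _ _⟩⟩
  obtain ⟨a, ha⟩ := exists_ne (0 : V)
  refine ⟨a, fun b => Submodule.mem_span_singleton.1 ?_⟩
  by_contra hb
  obtain ⟨f, hfb, hf⟩ := Submodule.exists_le_ker_of_notMem hb
  have hfa : f a = 0 := hf (Submodule.mem_span_singleton_self a)
  have transvection_fixes_b : b + f b • a = b :=
    DFunLike.congr_fun (Subsingleton.elim (LinearEquiv.transvection hfa) (.refl K V)) b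
  rw [add_eq_left, smul_eq_zero] at transvection_fixes_b
  exact transvection_fixes_b.elim hfb ha

theorem card_le_two_of_subsingleton_mulAut {G : Type*} [Group G] [Subsingleton (MulAut G)] :
    Nat.card G ≤ 2 := by
  have mul_comm (x y : G) : x * y = y * x := by
    have := DFunLike.congr_fun (Subsingleton.elim (MulAut.conj x) 1) y
    simpa only [MulAut.conj_apply, MulAut.one_apply, mul_inv_eq_iff_eq_mul] using this
  let : CommGroup G := { mul_comm }
  have sq_eq_one (x : G) : x ^ 2 = 1 := by
    have inv_eq : x⁻¹ = x := DFunLike.congr_fun (Subsingleton.elim (MulEquiv.inv G) 1) x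
    rw [sq, ← inv_eq_iff_mul_eq_one, inv_eq]
  let : Module (ZMod 2) (Additive G) := AddCommGroup.zmodModule sq_eq_one
  have : Subsingleton (Additive G ≃ₗ[ZMod 2] Additive G) := by
    refine Function.Injective.subsingleton (β := MulAut G)
      (f := fun e => MulEquiv.toAdditive.symm e.toAddEquiv) fun e e' h => ?_
    have toAddEquiv_eq : e.toAddEquiv = e'.toAddEquiv := MulEquiv.toAdditive.symm.injective h
    exact LinearEquiv.ext fun v => DFunLike.congr_fun toAddEquiv_eq v
  obtain ⟨a, ha⟩ := rank_le_one_iff.1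
    (rank_le_one_of_subsingleton_linearEquiv (K := ZMod 2) (V := Additive G))
  calc Nat.card G ≤ Nat.card (ZMod 2) := Nat.card_le_card_of_surjective (· • a) ha
    _ = 2 := Nat.card_zmod 2

end TrivialAutomorphismGroup

section Rank

theorem index_range_powMonoidHom_dvd (A : Type*) [CommGroup A] [Group.FG A] (n : ℕ) :
    (powMonoidHom n : A →* A).range.index ∣ n ^ Group.rank A := by
  let P := (powMonoidHom n : A →* A).range
  have pow_eq_one (q : A ⧸ P) : q ^ n = 1 := by
    obtain ⟨a, rfl⟩ := QuotientGroup.mk_surjective q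
    exact (QuotientGroup.eq_one_iff _).2 ⟨a, rfl⟩
  exact (card_dvd_exponent_pow_rank' (A ⧸ P) pow_eq_one).trans <| pow_dvd_pow n <|
    Group.rank_le_of_surjective (QuotientGroup.mk' P) (QuotientGroup.mk'_surjective P)

variable {G : Type*} [Group G]

theorem isCyclic_of_rank_le_one [Group.FG G] (h : Group.rank G ≤ 1) : IsCyclic G := by
  obtain ⟨S, hS, hS_top⟩ := Group.rank_spec G
  obtain ⟨a, ha⟩ := Finset.card_le_one_iff_subset_singleton.1 (hS.trans_le h)
  rw [isCyclic_iff_exists_zpowers_eq_top]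
  refine ⟨a, top_le_iff.1 ?_⟩
  rw [← hS_top, zpowers_eq_closure]
  exact closure_mono (by exact_mod_cast ha)

theorem index_center_eq_one_of_rank_le_one [Group.FG G] (h : Group.rank G ≤ 1) :
    (center G).index = 1 := by
  have := isCyclic_of_rank_le_one h
  let := IsCyclic.commGroup (α := G)
  rw [index_eq_one]
  exact CommGroup.center_eq_top

theorem ker_conj_eq_center : (MulAut.conj : G →* MulAut G).ker = center G := by
  ext x
  simp only [MonoidHom.mem_ker, mem_center_iff, MulEquiv.ext_iff, MulAut.conj_apply,
    MulAut.one_apply, mul_inv_eq_iff_eq_mul]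
  exact forall_congr' fun y => eq_comm

theorem index_center_le_card_mulAut [Finite (MulAut G)] :
    (center G).index ≤ Nat.card (MulAut G) := by
  rw [← ker_conj_eq_center, index_ker]
  exact card_le_card_group _

end Rank

section BoundedOrbits

variable {G : Type*} [Group G] [Finite G] {c : ℕ}

theorem card_mulAut_le_pow_rank (hc : ∀ x : G, (MulAction.orbit (MulAut G) x).ncard ≤ c) :
    Nat.card (MulAut G) ≤ c ^ Group.rank G := by
  obtain ⟨S, hS, hS_top⟩ := Group.rank_spec G
  let restrict (a : MulAut G) (s : S) : MulAction.orbit (MulAut G) (s : G) := ⟨a • (s : G), a, rfl⟩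
  have restrict_injective : Function.Injective restrict := fun a b hab =>
    MulEquiv.toMonoidHom_injective <| MonoidHom.eq_of_eqOn_dense hS_top fun s hs =>
      congrArg Subtype.val (congrFun hab ⟨s, hs⟩)
  calc Nat.card (MulAut G)
      ≤ ∏ s : S, Nat.card (MulAction.orbit (MulAut G) (s : G)) := by
        rw [← Nat.card_pi]
        exact Nat.card_le_card_of_injective restrict restrict_injective
    _ ≤ c ^ Fintype.card S :=
        Finset.prod_le_pow_card _ _ c fun s _ => (Nat.card_coe_set_eq _).trans_le (hc s)
    _ = c ^ Group.rank G := by rw [Fintype.card_coe, hS]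

theorem card_range_transferCenterPow_le
    (hc : ∀ x : G, (MulAction.orbit (MulAut G) x).ncard ≤ c) :
    Nat.card (MonoidHom.transferCenterPow G).range ≤ (2 * c ^ 2) ^ Group.rank G := by
  set T := (MonoidHom.transferCenterPow G).range
  obtain ⟨⟨_, g, rfl⟩, hg⟩ :=
    Monoid.exists_orderOf_eq_exponent (G := T) Monoid.ExponentExists.of_finite
  have exponent_le : Monoid.exponent T ≤ 2 * c ^ 2 := by
    rw [← hg, ← orderOf_coe, ← orderOf_coe, MonoidHom.transferCenterPow_apply]
    grw [le_two_mul_totient_sq (orderOf _), totient_orderOf_pow_index_center_le g, hc g]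
  have exponent_pos : 0 < Monoid.exponent T := Monoid.ExponentExists.of_finite.exponent_pos
  calc Nat.card T ≤ Monoid.exponent T ^ Group.rank T :=
        Nat.le_of_dvd (pow_pos exponent_pos _) (card_dvd_exponent_pow_rank T)
    _ ≤ Monoid.exponent T ^ Group.rank G := Nat.pow_le_pow_right exponent_pos Group.rank_range_le
    _ ≤ (2 * c ^ 2) ^ Group.rank G := Nat.pow_le_pow_left exponent_le _

theorem card_le_index_center_mul_pow
    (hc : ∀ x : G, (MulAction.orbit (MulAut G) x).ncard ≤ c) :
    Nat.card G ≤ (center G).index * (center G).index ^ ((center G).index * Group.rank G) *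
      (2 * c ^ 2) ^ Group.rank G := by
  set m := (center G).index
  have hm : 0 < m := Nat.pos_of_ne_zero FiniteIndex.index_ne_zero
  let P := (powMonoidHom m : center G →* center G).range
  have card_P_le : Nat.card P ≤ (2 * c ^ 2) ^ Group.rank G := by
    have P_le : P ≤ (MonoidHom.transferCenterPow G).range := by
      rintro _ ⟨z, rfl⟩
      exact ⟨z, Subtype.ext (MonoidHom.transferCenterPow_apply _)⟩
    exact (card_le_of_le P_le).trans (card_range_transferCenterPow_le hc)
  have index_P_le : P.index ≤ m ^ (m * Group.rank G) :=
    (Nat.le_of_dvd (pow_pos hm _) (index_range_powMonoidHom_dvd (center G) m)).trans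
      (Nat.pow_le_pow_right hm (rank_le_index_mul_rank (center G)))
  rw [← (center G).index_mul_card, ← P.index_mul_card, ← mul_assoc]
  gcongr

theorem mul_pow_mul_two_mul_sq_pow_le {m r : ℕ} (hc : 2 ≤ c) (hm : m ≤ c ^ r)
    (hr : r ≤ 1 → m = 1) :
    m * m ^ (m * r) * (2 * c ^ 2) ^ r ≤ c ^ (r * c ^ r * (1 + r)) := by
  have two_mul_sq_le : 2 * c ^ 2 ≤ c ^ 3 := by rw [pow_succ' c 2]; gcongr
  rcases Nat.lt_or_ge 1 r with hr2 | hr1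
  · set N := c ^ r with hN
    have four_le : 4 ≤ N := (Nat.pow_le_pow_left hc 2).trans (Nat.pow_le_pow_right (by lia) hr2)
    calc m * m ^ (m * r) * (2 * c ^ 2) ^ r ≤ N * N ^ (N * r) * (c ^ 3) ^ r := by
          gcongr
          lia
      _ = c ^ (r * (4 + N * r)) := by
          simp only [hN, ← pow_mul, ← pow_add]
          congr 1
          ring
      _ ≤ c ^ (r * (N + N * r)) := by gcongr; lia
      _ = c ^ (r * N * (1 + r)) := by ring_nf
  · rw [hr hr1, one_pow, one_mul, one_mul]
    interval_cases r
    · simp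
    · calc (2 * c ^ 2) ^ 1 ≤ c ^ 3 := by rwa [pow_one]
        _ ≤ c ^ (1 * c ^ 1 * (1 + 1)) := Nat.pow_le_pow_right (by lia) (by lia)

theorem card_le_pow_of_ncard_orbit_mulAut_le (hc2 : 2 ≤ c)
    (hc : ∀ x : G, (MulAction.orbit (MulAut G) x).ncard ≤ c) :
    Nat.card G ≤ c ^ (Group.rank G * c ^ Group.rank G * (1 + Group.rank G)) :=
  (card_le_index_center_mul_pow hc).trans <| mul_pow_mul_two_mul_sq_pow_le hc2
    (index_center_le_card_mulAut.trans (card_mulAut_le_pow_rank hc))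
    index_center_eq_one_of_rank_le_one

theorem card_le_two_of_ncard_orbit_mulAut_le_one
    (hc : ∀ x : G, (MulAction.orbit (MulAut G) x).ncard ≤ 1) : Nat.card G ≤ 2 := by
  have : Subsingleton (MulAut G) := by
    rw [← Finite.card_le_one_iff_subsingleton]
    exact (card_mulAut_le_pow_rank hc).trans_eq (one_pow _)
  exact card_le_two_of_subsingleton_mulAut

end BoundedOrbits

theorem rank_le_of_closure_range_eq_top {G : Type*} [Group G] [Group.FG G] {d : ℕ} {g : Fin d → G}
    (hg : closure (Set.range g) = ⊤) : Group.rank G ≤ d := by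
  classical
  calc Group.rank G ≤ (Finset.univ.image g).card := Group.rank_le (by simpa using hg)
    _ ≤ d := Finset.card_image_le.trans_eq (Finset.card_fin d)

theorem le_floor_mul_logb_two (d : ℕ) {c : ℕ} (hc : 2 ≤ c) :
    d ≤ ⌊(d : ℝ) * Real.logb 2 (c : ℝ)⌋₊ := by
  refine Nat.le_floor (le_mul_of_one_le_right d.cast_nonneg ?_)
  rw [Real.le_logb_iff_rpow_le one_lt_two (by positivity), Real.rpow_one]
  exact_mod_cast hc

theorem theorem1p2 {G : Type*} [Group G] [Finite G] (d c : ℕ)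
    (hd : ∃ g : Fin d → G, Subgroup.closure (Set.range g) = ⊤)
    (hc : ∀ x : G, (MulAction.orbit (MulAut G) x).ncard ≤ c) :
    Nat.card G ≤ c ^ (d * c ^ d * (1 + ⌊(d : ℝ) * Real.logb 2 (c : ℝ)⌋₊)) + 1 := by
  obtain ⟨g, hg⟩ := hd
  have hrank : Group.rank G ≤ d := rank_le_of_closure_range_eq_top hg
  have hc1 : 1 ≤ c :=
    ((Set.ncard_pos (Set.toFinite _)).2 (MulAction.nonempty_orbit (1 : G))).trans_le (hc 1)
  rcases hc1.eq_or_lt with rfl | hc2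
  · rw [one_pow]
    exact card_le_two_of_ncard_orbit_mulAut_le_one hc
  · calc Nat.card G ≤ c ^ (Group.rank G * c ^ Group.rank G * (1 + Group.rank G)) :=
          card_le_pow_of_ncard_orbit_mulAut_le hc2 hc
      _ ≤ c ^ (d * c ^ d * (1 + ⌊(d : ℝ) * Real.logb 2 (c : ℝ)⌋₊)) := by
          gcongr
          exact hrank.trans (le_floor_mul_logb_two d hc2)
      _ ≤ _ := Nat.le_succ _
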